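/- Let $A$ be a finite-dimensional real affine space with its usual topology. Polytopes in $A$ (not necessarily convex) are defined recursively: a $0$-polytope is a single point; for $d>0$, a $d$-polytope is a subset $X\subseteq A$ with $\dim\operatorname{Aff}(X)=d$, homeomorphic to a closed $d$-ball, whose boundary $\partial X$ (the manifold boundary of $X$, equal to its boundary relative to $\operatorname{Aff}(X)$) is a finite union of $(d-1)$-polytopes. A polytopal mesh $M$ in $A$ is a finite (possibly empty) set of polytopes, called cells, in which each $p$-cell $c$ ($p\ge 1$) comes with certain $(p-1)$-cells of $M$, its hyperfaces, whose union is $\partial c$. The faces of a cell $c$ are the cells reached from $c$ by descending chains of hyperfaces (including $c$ itself). It is required that the intersection of any two cells is a (possibly empty) union of common faces of both. Let $M_p$ be the set of $p$-cells; if $M\neq\emptyset$, its dimension $d$ is the largest $p$ with $M_p\ne\emptyset$. An orientation of $M$ assigns to each $p$-cell $c$ a class $\mathrm{OR}(c)$ of nonzero elements of $\Lambda^p V_c$ modulo positive scalars, where $V_c$ is the direction of $\operatorname{Aff}(c)$; no compatibility between cells is required. Regard $\Lambda^\bullet W$ as a subspace of $\Lambda^\bullet V_c$ for every subspace $W\subseteq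 V_c$. For a hyperface $b$ of a cell $c$, let $\mathbf n\in V_c$ be outward-pointing: for every $x$ in the relative interior of $b$ and all sufficiently small $t>0$, $x+t\mathbf n\notin c$ and $x-t\mathbf n$ lies in the relative interior of $c$. The relative orientation is $\varepsilon(c,b)=1$ if $[\mathbf n]\wedge\mathrm{OR}(b)=\mathrm{OR}(c)$ and $\varepsilon(c,b)=-1$ otherwise (that is, if $[\mathbf n]\wedge\mathrm{OR}(b)=-\mathrm{OR}(c)$). Let $C_pM$ be the free real vector space on $M_p$, and for $p\ge 1$ let $\partial_p\colon C_pM\to C_{p-1}M$ be the linear map with $$\partial_p c=\sum_{b\text{ hyperface of }c}\varepsilon(c,b)\,b\qquad(c\in M_p).$$ Theorem. For every oriented polytopal mesh $M$, $\partial_{p-1}\circ\partial_p=0$ for all $p\ge 2$. Hence $(C_\bullet M,\partial)$ is a chain complex; if $M$ is nonempty of dimension $d$, its spaces vanish in degrees above $d$, so it has the form $$0\to C_dM\xrightarrow{\partial_d}C_{d-1}M\to\cdots\xrightarrow{\partial_2}C_1M\xrightarrow{\partial_1}C_0M\to 0.$$ -/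

import Mathlib

open CategoryTheory

noncomputable section

namespace PolyMesh

section

variable {V A : Type*} [NormedAddCommGroup V] [NormedSpace ℝ V] [MetricSpace A] [NormedAddTorsor V A]

/-- `X` is a closed topological ball of dimension `d` lying flat in its affine hull: a homeomorphism
from the closed unit ball of `ℝ^d` onto `X` carries the unit sphere onto the boundary `∂X`. Here `∂X`
is the boundary of `X` relative to its affine hull (`intrinsicFrontier`), which for a `d`-dimensional
flat `X` is the same thing as the boundary of `X` as a manifold. -/
def IsFlatBall (d : ℕ) (X : Set A) : Prop :=
  Module.finrank ℝ (vectorSpan ℝ X) = d ∧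
    ∃ e : Metric.closedBall (0 : EuclideanSpace ℝ (Fin d)) 1 ≃ₜ X,
      ∀ z, (e z : A) ∈ intrinsicFrontier ℝ X ↔ ‖(z : EuclideanSpace ℝ (Fin d))‖ = 1

/-- `d`-dimensional polytopes (not necessarily convex): points for `d = 0`; for `d > 0`, flat closed
`d`-balls whose boundary is a finite union of `(d - 1)`-polytopes. -/
def IsPolytope : ℕ → Set A → Prop
  | 0, X => ∃ a : A, X = {a}
  | d + 1, X => IsFlatBall (d + 1) X ∧
      ∃ S : Set (Set A), S.Finite ∧ (∀ Y ∈ S, IsPolytope d Y) ∧ intrinsicFrontier ℝ X = ⋃₀ S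

end

/-- A polytopal mesh in `A`: a finite, possibly empty, set of polytopes. A set may be the union of
hyperfaces in several ways (a side of a square may be subdivided), so the mesh records which
`p`-cells are the hyperfaces of a given `(p + 1)`-cell. Faces are the cells reached by descending
chains of hyperfaces. -/
structure Mesh (V A : Type*) [NormedAddCommGroup V] [NormedSpace ℝ V] [MetricSpace A]
    [NormedAddTorsor V A] where
  cells : Set (Set A)
  finite_cells : cells.Finite
  isPolytope_cells : ∀ c ∈ cells, ∃ p, IsPolytope p c
  /-- `IsHyperface b c`: the cell `b` is a hyperface of the cell `c`. -/
  IsHyperface : Set A → Set A → Prop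
  /-- Hyperfaces of a cell are cells of the mesh, of dimension one less. -/
  hyperface_mem : ∀ b c, IsHyperface b c →
    b ∈ cells ∧ c ∈ cells ∧ ∃ p, IsPolytope p b ∧ IsPolytope (p + 1) c
  /-- The hyperfaces of a cell form its boundary. -/
  boundary_eq : ∀ p, ∀ c ∈ cells, IsPolytope (p + 1) c →
    intrinsicFrontier ℝ c = ⋃₀ {b | IsHyperface b c}
  /-- Two cells intersect in a (possibly empty) union of common faces. -/
  inter_eq : ∀ X ∈ cells, ∀ Y ∈ cells, ∃ S : Set (Set A),
    (∀ Z ∈ S, Relation.ReflTransGen IsHyperface Z X ∧ Relation.ReflTransGen IsHyperface Z Y) ∧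
      X ∩ Y = ⋃₀ S

namespace Mesh

variable {V A : Type*} [NormedAddCommGroup V] [NormedSpace ℝ V] [MetricSpace A]
  [NormedAddTorsor V A] (M : Mesh V A)

/-- The set `M_p` of `p`-cells. -/
abbrev Cell (p : ℕ) : Type _ := {c : Set A // c ∈ M.cells ∧ IsPolytope p c}

instance (p : ℕ) : Finite (M.Cell p) :=
  (M.finite_cells.subset (fun _ h => h.1 : {c | c ∈ M.cells ∧ IsPolytope p c} ⊆ M.cells)).to_subtype

instance (p : ℕ) : Fintype (M.Cell p) := Fintype.ofFinite _

/-- `M` is a `d`-mesh: `d` is the maximal dimension of its cells. -/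
def HasDim (d : ℕ) : Prop := IsGreatest {p | Nonempty (M.Cell p)} d

/-- An oriented mesh: each `p`-cell `c` has an orientation, a class of nonzero `p`-vectors on the
direction of its affine hull up to positive multiples. No compatibility is asked for. -/
def Orientation : Type _ :=
  ∀ (p : ℕ) (c : M.Cell p), Module.Ray ℝ (⋀[ℝ]^p (vectorSpan ℝ c.1))

end Mesh

section

variable {V A : Type*} [NormedAddCommGroup V] [NormedSpace ℝ V] [MetricSpace A]
  [NormedAddTorsor V A]

/-- `n` points outward from `c` along `b`: from each interior point of `b`, a short move along `n`
leaves `c`, and a short move along `-n` enters the interior of `c`. Interiors are relative to affine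
hulls. -/
def IsOutward (c b : Set A) (n : V) : Prop :=
  n ∈ vectorSpan ℝ c ∧ ∀ x ∈ intrinsicInterior ℝ b, ∃ δ > 0, ∀ t : ℝ, 0 < t → t < δ →
    (t • n) +ᵥ x ∉ c ∧ (-(t • n)) +ᵥ x ∈ intrinsicInterior ℝ c

/-- A `p`-vector on a subspace `W` seen in the exterior algebra of `V`. -/
def toAmbient {p : ℕ} (W : Submodule ℝ V) (ω : ⋀[ℝ]^p W) : ExteriorAlgebra ℝ V :=
  ExteriorAlgebra.map W.subtype (ω : ExteriorAlgebra ℝ W)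

/-- The nonzero `p`-vector `ω` represents the orientation class `o`. -/
def Represents {p : ℕ} {W : Submodule ℝ V} (ω : ⋀[ℝ]^p W) (o : Module.Ray ℝ (⋀[ℝ]^p W)) : Prop :=
  ∃ h : ω ≠ 0, rayOfNeZero ℝ ω h = o

end

namespace Mesh

variable {V A : Type*} [NormedAddCommGroup V] [NormedSpace ℝ V] [MetricSpace A]
  [NormedAddTorsor V A] {M : Mesh V A}

open Classical in
/-- The relative orientation `ε(c, b)`, i.e. `([n] ∧ OR(b)) / OR(c)` with `n` pointing outward from
`c` along `b`: it is `1` if `n ∧ OR(b)` is the class `OR(c)`, and `-1` otherwise. -/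
def relOrientation (o : M.Orientation) {p : ℕ} (c : M.Cell (p + 1)) (b : M.Cell p) : ℝ :=
  if ∃ n : V, IsOutward c.1 b.1 n ∧ ∃ ω η, Represents ω (o p b) ∧ Represents η (o (p + 1) c) ∧
      ExteriorAlgebra.ι ℝ n * toAmbient _ ω = toAmbient _ η
  then 1 else -1

/-- The real vector space `C_p M` of `p`-chains, free on the `p`-cells. -/
abbrev Chain (M : Mesh V A) (p : ℕ) : Type _ := M.Cell p →₀ ℝ

open Classical in
/-- The boundary operator `∂_{p+1} : C_{p+1} M → C_p M`,
`∂ c = ∑ ε(c, b) b` over the hyperfaces `b` of `c`. -/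
def boundary (o : M.Orientation) (p : ℕ) : M.Chain (p + 1) →ₗ[ℝ] M.Chain p :=
  Finsupp.linearCombination ℝ fun c : M.Cell (p + 1) =>
    ∑ b : M.Cell p with M.IsHyperface b.1 c.1, Finsupp.single b (relOrientation o c b)

end Mesh

end PolyMesh

end

noncomputable section

namespace PolyMesh

/-! ### Exterior powers of subspaces and the sign defining relative orientation -/

section

variable {V : Type*} [NormedAddCommGroup V] [NormedSpace ℝ V]

/-! The coefficient of a `p`-cell `a` in `∂∂c` is the sum of `ε(c,b) ε(b,a)` over the cells `b`
between `a` and `c`. It vanishes because a small closed loop around `a` inside the affine hull of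
`c` enters `c` as often as it leaves it.

Fix a relative interior point `x` of `a`. By the intersection axiom every hyperface of `c` through
`x` has `a` as a hyperface, and near `x` it is a half-hyperplane `G i ≤ 0` with edge along `a`.
Across its interior, `c` lies on exactly one side, given by a linear functional `F i` whose sign is
the same along the whole of `b i` (`exists_halfSpace`, `exists_isSideFunctional`).

The loop is a parallelogram with corners `±q ± w`, with `w` so long relative to `q` that every
hyperplane `F i = 0` crosses only the two sides parallel to `w`, at opposite points `±(q + t i •
w)`. The half-hyperplane `b i` contains exactly one of these, the one with sign `τ i`. The indicator
of `c` jumps there by `-τ i * sign (F i w)`, and the jumps around the loop add up to zero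
(`sub_eq_sum_jumps`, `exists_alternating`).

The same numbers appear in the exterior algebra: `sign (F i w) • w` points out of `c` along `b i`,
and `-τ i • (q + t i • w)` points out of `b i` along `a`. Since `w ∧ w = 0`, their wedge with
`OR(a)` is `-τ i * sign (F i w)` times `w ∧ q ∧ OR(a)`, which does not depend on `i`. So `ε(c,b)
ε(b,a)` is a common factor times the jump (`sum_relOrientation_mul_eq_zero`). -/

lemma toAmbient_injective {p : ℕ} (W : Submodule ℝ V) :
    Function.Injective (toAmbient (p := p) W) := fun _ _ h =>
  Subtype.ext (ExteriorAlgebra.map_injective_field (LinearMap.ker_eq_bot.mpr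
    W.subtype_injective) h)

lemma toAmbient_smul {p : ℕ} (W : Submodule ℝ V) (s : ℝ) (ω : ⋀[ℝ]^p W) :
    toAmbient W (s • ω) = s • toAmbient W ω := by
  simp [toAmbient]

lemma toAmbient_zero {p : ℕ} (W : Submodule ℝ V) : toAmbient W (0 : ⋀[ℝ]^p W) = 0 := by
  simp [toAmbient]

lemma exists_toAmbient_eq_of_le {p : ℕ} {U W : Submodule ℝ V} (h : U ≤ W) (ω : ⋀[ℝ]^p U) :
    ∃ η : ⋀[ℝ]^p W, toAmbient W η = toAmbient U ω := by
  refine ⟨⟨ExteriorAlgebra.map (Submodule.inclusion h) ω, ?_⟩, ?_⟩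
  · have h1 := Submodule.mem_map_of_mem
      (f := (ExteriorAlgebra.map (Submodule.inclusion h)).toLinearMap) ω.2
    rw [Submodule.map_pow] at h1
    refine pow_le_pow_left' (?_ : _ ≤ LinearMap.range (ExteriorAlgebra.ι ℝ)) p h1
    rintro _ ⟨_, ⟨m, rfl⟩, rfl⟩
    exact ⟨Submodule.inclusion h m, (ExteriorAlgebra.map_apply_ι _ _).symm⟩
  · rw [toAmbient, toAmbient, ← AlgHom.comp_apply, ExteriorAlgebra.map_comp_map]
    rfl

lemma exists_toAmbient_eq_ι_mul {p : ℕ} {W : Submodule ℝ V} {n : V} (hn : n ∈ W)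
    (ω : ⋀[ℝ]^p W) :
    ∃ η : ⋀[ℝ]^(p + 1) W, toAmbient W η = ExteriorAlgebra.ι ℝ n * toAmbient W ω := by
  refine ⟨⟨ExteriorAlgebra.ι ℝ (⟨n, hn⟩ : W) * ω, ?_⟩, ?_⟩
  · change _ ∈ (LinearMap.range (ExteriorAlgebra.ι ℝ : W →ₗ[ℝ] _)) ^ (p + 1)
    rw [pow_succ']
    exact Submodule.mul_mem_mul ⟨_, rfl⟩ ω.2
  · simp [toAmbient]

lemma exists_smul_of_finrank_eq {p : ℕ} {W : Submodule ℝ V} [FiniteDimensional ℝ W]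
    (hW : Module.finrank ℝ W = p) {η : ⋀[ℝ]^p W} (hη : η ≠ 0) (ω : ⋀[ℝ]^p W) :
    ∃ s : ℝ, ω = s • η := by
  have h1 : Module.finrank ℝ (⋀[ℝ]^p W) = 1 := by
    rw [exteriorPower.finrank_eq, hW, Nat.choose_self]
  obtain ⟨s, hs⟩ := (finrank_eq_one_iff_of_nonzero' η hη).mp h1 ω
  exact ⟨s, hs.symm⟩

lemma ι_mul_toAmbient_eq_zero {p : ℕ} {W : Submodule ℝ V} [FiniteDimensional ℝ W]
    (hW : Module.finrank ℝ W = p) {n : V} (hn : n ∈ W) (ω : ⋀[ℝ]^p W) :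
    ExteriorAlgebra.ι ℝ n * toAmbient W ω = 0 := by
  obtain ⟨η, hη⟩ := exists_toAmbient_eq_ι_mul hn ω
  have h0 : Module.finrank ℝ (⋀[ℝ]^(p + 1) W) = 0 := by
    rw [exteriorPower.finrank_eq, hW, Nat.choose_succ_self]
  have : Subsingleton (⋀[ℝ]^(p + 1) W) := Module.finrank_zero_iff.mp h0
  rw [← hη, Subsingleton.elim η 0, toAmbient_zero]

lemma contractLeft_map_eq_zero {U : Submodule ℝ V} {d : Module.Dual ℝ V}
    (hd : U ≤ LinearMap.ker d) (x : ExteriorAlgebra ℝ U) :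
    CliffordAlgebra.contractLeft d (ExteriorAlgebra.map U.subtype x) = 0 := by
  induction x using CliffordAlgebra.left_induction with
  | algebraMap r =>
    rw [AlgHom.commutes]
    exact CliffordAlgebra.contractLeft_algebraMap _ d r
  | add x y hx hy => rw [map_add, map_add, hx, hy, add_zero]
  | ι_mul x m hx =>
    rw [map_mul, show ExteriorAlgebra.map U.subtype (CliffordAlgebra.ι 0 m) =
      CliffordAlgebra.ι 0 (m : V) from ExteriorAlgebra.map_apply_ι _ _,
      CliffordAlgebra.contractLeft_ι_mul, hx, mul_zero, sub_zero,
      show d (m : V) = 0 from hd m.2, zero_smul]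

/-- Contraction with a functional that vanishes on `U` but not at `n` turns `n ∧ ω` back into a
nonzero multiple of `ω`. -/
lemma ι_mul_toAmbient_ne_zero {p : ℕ} {U : Submodule ℝ V} {n : V} (hn : n ∉ U)
    {ω : ⋀[ℝ]^p U} (hω : ω ≠ 0) :
    ExteriorAlgebra.ι ℝ n * toAmbient U ω ≠ 0 := by
  intro h
  obtain ⟨d, hd, hU⟩ := Submodule.exists_le_ker_of_notMem hn
  have h1 := congrArg (CliffordAlgebra.contractLeft d) h
  rw [map_zero, CliffordAlgebra.contractLeft_ι_mul, toAmbient, contractLeft_map_eq_zero hU,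
    mul_zero, sub_zero] at h1
  have h2 := (smul_eq_zero.mp h1).resolve_left hd
  exact hω (toAmbient_injective U (by rw [toAmbient_zero]; exact h2))

lemma exists_represents {p : ℕ} {W : Submodule ℝ V} (o : Module.Ray ℝ (⋀[ℝ]^p W)) :
    ∃ ω : ⋀[ℝ]^p W, Represents ω o := by
  induction o using Module.Ray.ind with
  | h v hv => exact ⟨v, hv, rfl⟩

lemma Represents.smul {p : ℕ} {W : Submodule ℝ V} {o : Module.Ray ℝ (⋀[ℝ]^p W)}
    {ω : ⋀[ℝ]^p W} (h : Represents ω o) {s : ℝ} (hs : 0 < s) : Represents (s • ω) o := by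
  obtain ⟨h0, rfl⟩ := h
  refine ⟨smul_ne_zero hs.ne' h0, ?_⟩
  rw [ray_eq_iff]
  exact SameRay.sameRay_pos_smul_left ω hs

lemma Represents.exists_smul {p : ℕ} {W : Submodule ℝ V} {o : Module.Ray ℝ (⋀[ℝ]^p W)}
    {ω η : ⋀[ℝ]^p W} (h : Represents ω o) (h' : Represents η o) : ∃ s : ℝ, 0 < s ∧ η = s • ω := by
  obtain ⟨h0, rfl⟩ := h
  obtain ⟨h1, h2⟩ := h'
  rw [ray_eq_iff] at h2
  obtain ⟨s, hs, hs'⟩ := h2.exists_pos_left h1 h0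
  exact ⟨s⁻¹, inv_pos.mpr hs, by rw [← hs', smul_smul, inv_mul_cancel₀ hs.ne', one_smul]⟩

variable {A : Type*} [MetricSpace A] [NormedAddTorsor V A]

/-- The relative orientation is the sign of the coefficient comparing `n ∧ OR(b)` with `OR(c)`. -/
lemma Mesh.relOrientation_eq_sign {M : Mesh V A} (o : M.Orientation) {p : ℕ}
    {c : M.Cell (p + 1)} {b : M.Cell p} (f : V →ₗ[ℝ] ℝ)
    [FiniteDimensional ℝ (vectorSpan ℝ b.1)]
    (hb : Module.finrank ℝ (vectorSpan ℝ b.1) = p)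
    (hf : ∀ v ∈ vectorSpan ℝ c.1, f v = 0 → v ∈ vectorSpan ℝ b.1)
    (hout : ∀ n, IsOutward c.1 b.1 n ↔ n ∈ vectorSpan ℝ c.1 ∧ 0 < f n)
    {n : V} (hn : IsOutward c.1 b.1 n) {ω η} (hω : Represents ω (o p b))
    (hη : Represents η (o (p + 1) c)) {s : ℝ} (hs : s ≠ 0)
    (h : ExteriorAlgebra.ι ℝ n * toAmbient _ ω = s • toAmbient _ η) :
    relOrientation o c b = Real.sign s := by
  rw [relOrientation]
  rcases hs.lt_or_gt with hs | hs
  · rw [Real.sign_of_neg hs, if_neg]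
    rintro ⟨n', hn', ω', η', hω', hη', h'⟩
    obtain ⟨k, hk, rfl⟩ := hω.exists_smul hω'
    obtain ⟨l, hl, rfl⟩ := hη.exists_smul hη'
    obtain ⟨hnc, hn0⟩ := (hout n).mp hn
    obtain ⟨hnc', hn0'⟩ := (hout n').mp hn'
    -- Up to a positive factor two outward vectors differ by a vector along `b`, which the
    -- top-degree form `ω` kills. Hence the sign does not depend on the outward vector.
    have hmem : n' - (f n' / f n) • n ∈ vectorSpan ℝ b.1 := by
      refine hf _ (Submodule.sub_mem _ hnc' (Submodule.smul_mem _ _ hnc)) ?_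
      rw [map_sub, map_smul, smul_eq_mul, div_mul_cancel₀ _ hn0.ne', sub_self]
    have h1 := ι_mul_toAmbient_eq_zero hb hmem ω
    rw [map_sub, map_smul, sub_mul, smul_mul_assoc, h, sub_eq_zero] at h1
    rw [toAmbient_smul, toAmbient_smul, mul_smul_comm, h1, ← toAmbient_smul, ← toAmbient_smul,
      ← toAmbient_smul, ← toAmbient_smul] at h'
    have h2 := toAmbient_injective _ h'
    rw [smul_smul, smul_smul] at h2
    have h3 := smul_left_injective ℝ hη.choose h2
    have h4 : k * (f n' / f n) * s < 0 :=
      mul_neg_of_pos_of_neg (mul_pos hk (div_pos hn0' hn0)) hs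
    linarith
  · rw [Real.sign_of_pos hs, if_pos]
    exact ⟨n, hn, ω, s • η, hω, hη.smul hs, by rw [h, toAmbient_smul]⟩

end

/-! ### Relative interiors and frontiers of closed sets -/

lemma exists_ball_disjoint {V A : Type*} [NormedAddCommGroup V] [MetricSpace A]
    [NormedAddTorsor V A] {s : Set A} (hs : IsClosed s) {x : A} (hx : x ∉ s) :
    ∃ r > 0, ∀ v : V, ‖v‖ < r → v +ᵥ x ∉ s := by
  obtain ⟨r, hr, h⟩ := Metric.isOpen_iff.mp hs.isOpen_compl x hx
  exact ⟨r, hr, fun v hv => h (by simpa using hv)⟩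

section

variable {V A : Type*} [NormedAddCommGroup V] [NormedSpace ℝ V] [MetricSpace A]
  [NormedAddTorsor V A]

lemma vadd_mem_affineSpan {s : Set A} {x : A} (hx : x ∈ s) {v : V} (hv : v ∈ vectorSpan ℝ s) :
    v +ᵥ x ∈ affineSpan ℝ s :=
  AffineSubspace.vadd_mem_of_mem_direction (by rwa [direction_affineSpan])
    (subset_affineSpan ℝ s hx)

lemma mem_intrinsicInterior_iff {s : Set A} {x : A} : x ∈ intrinsicInterior ℝ s ↔
    x ∈ s ∧ ∃ r > 0, ∀ v ∈ vectorSpan ℝ s, ‖v‖ < r → v +ᵥ x ∈ s := by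
  constructor
  · intro h
    refine ⟨intrinsicInterior_subset h, ?_⟩
    have hx := intrinsicInterior_subset h
    obtain ⟨y, hy, rfl⟩ := mem_intrinsicInterior.mp h
    obtain ⟨r, hr, hb⟩ := Metric.mem_nhds_iff.mp (mem_interior_iff_mem_nhds.mp hy)
    refine ⟨r, hr, fun v hv hvr => ?_⟩
    exact hb (a := ⟨v +ᵥ (y : A), vadd_mem_affineSpan hx hv⟩)
      (by rw [Metric.mem_ball, Subtype.dist_eq]; simpa using hvr)
  · rintro ⟨hx, r, hr, h⟩
    refine mem_intrinsicInterior.mpr ⟨⟨x, subset_affineSpan ℝ s hx⟩, ?_, rfl⟩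
    rw [mem_interior_iff_mem_nhds, Metric.mem_nhds_iff]
    refine ⟨r, hr, fun z hz => ?_⟩
    rw [Metric.mem_ball, Subtype.dist_eq, dist_eq_norm_vsub V] at hz
    have h1 := h ((z : A) -ᵥ x) (by
      rw [← direction_affineSpan]
      exact AffineSubspace.vsub_mem_direction z.2 (subset_affineSpan ℝ s hx)) hz
    rwa [vsub_vadd] at h1

lemma intrinsicClosure_eq_self {s : Set A} (hs : IsClosed s) : intrinsicClosure ℝ s = s :=
  (hs.preimage continuous_subtype_val).intrinsicClosure

lemma mem_intrinsicFrontier_iff {s : Set A} (hs : IsClosed s) {x : A} :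
    x ∈ intrinsicFrontier ℝ s ↔ x ∈ s ∧ x ∉ intrinsicInterior ℝ s := by
  rw [← intrinsicClosure_sdiff_intrinsicInterior, intrinsicClosure_eq_self hs, Set.mem_sdiff]

/-- Membership in a closed set is locally constant off its relative boundary. -/
lemma eventually_mem_iff {s : Set A} (hs : IsClosed s) {x : A} {u : V} (hu : u ∈ vectorSpan ℝ s)
    (hd : u +ᵥ x ∉ intrinsicFrontier ℝ s) :
    ∀ᶠ v in nhdsWithin u (vectorSpan ℝ s), (v +ᵥ x ∈ s ↔ u +ᵥ x ∈ s) := by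
  by_cases hus : u +ᵥ x ∈ s
  · have hi : u +ᵥ x ∈ intrinsicInterior ℝ s := by
      by_contra hi
      exact hd ((mem_intrinsicFrontier_iff hs).mpr ⟨hus, hi⟩)
    obtain ⟨-, r, hr, h⟩ := mem_intrinsicInterior_iff.mp hi
    filter_upwards [self_mem_nhdsWithin, mem_nhdsWithin_of_mem_nhds (Metric.ball_mem_nhds u hr)]
      with y hy hyr
    have := h (y - u) (Submodule.sub_mem _ hy hu) (by rwa [← dist_eq_norm])
    rw [vadd_vadd, sub_add_cancel] at this
    exact iff_of_true this hus
  · obtain ⟨r, hr, h⟩ := exists_ball_disjoint (V := V) hs hus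
    filter_upwards [mem_nhdsWithin_of_mem_nhds (Metric.ball_mem_nhds u hr)] with y hyr
    have := h (y - u) (by rwa [← dist_eq_norm])
    rw [vadd_vadd, sub_add_cancel] at this
    exact iff_of_false this hus

/-- Membership in a closed set is constant along a preconnected set of vectors in its direction
that misses its relative boundary. -/
lemma mem_of_isPreconnected {s : Set A} (hs : IsClosed s) {x : A} {H : Set V}
    (hH : IsPreconnected H) (hHs : H ⊆ vectorSpan ℝ s)
    (hd : ∀ v ∈ H, v +ᵥ x ∉ intrinsicFrontier ℝ s) {v w : V} (hv : v ∈ H) (hw : w ∈ H)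
    (h : v +ᵥ x ∈ s) : w +ᵥ x ∈ s := by
  refine hH.induction₂' (fun v w => v +ᵥ x ∈ s → w +ᵥ x ∈ s) (fun u hu => ?_)
    (fun _ _ _ _ _ _ h1 h2 h3 => h2 (h1 h3)) hv hw h
  filter_upwards [nhdsWithin_mono u hHs (eventually_mem_iff hs (hHs hu) (hd u hu))] with y hy
  exact ⟨hy.mpr, hy.mp⟩

/-- Local shape of a closed set near a point of a relative boundary which is locally a hyperplane:
a half-space. -/
lemma exists_halfSpace {s : Set A} (hs : IsClosed s) (hds : s ⊆ closure (intrinsicInterior ℝ s))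
    {x : A} (f : V →ₗ[ℝ] ℝ) {r : ℝ} (hr : 0 < r)
    (hf : ∀ v ∈ vectorSpan ℝ s, ‖v‖ < r → (v +ᵥ x ∈ intrinsicFrontier ℝ s ↔ f v = 0)) :
    (∀ v ∈ vectorSpan ℝ s, ‖v‖ < r → (v +ᵥ x ∈ s ↔ f v ≤ 0)) ∨
    (∀ v ∈ vectorSpan ℝ s, ‖v‖ < r → (v +ᵥ x ∈ s ↔ 0 ≤ f v)) := by
  have hxf : x ∈ intrinsicFrontier ℝ s := by
    simpa using (hf 0 (Submodule.zero_mem _) (by simpa using hr)).mpr (map_zero f)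
  obtain ⟨hxs, hxi⟩ := (mem_intrinsicFrontier_iff hs).mp hxf
  have hz : ∀ v ∈ vectorSpan ℝ s, ‖v‖ < r → f v = 0 → v +ᵥ x ∈ s := fun v hv hvr h0 =>
    ((mem_intrinsicFrontier_iff hs).mp ((hf v hv hvr).mpr h0)).1
  have key : ∀ ε : ℝ, IsPreconnected ((vectorSpan ℝ s : Set V) ∩ Metric.ball 0 r ∩
      {v | 0 < ε * f v}) := by
    intro ε
    refine (((vectorSpan ℝ s).convex.inter (convex_ball 0 r)).inter ?_).isPreconnected
    exact convex_halfSpace_gt (f := fun v => ε * f v)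
      ⟨fun a b => by simp [mul_add], fun c a => by simp; ring⟩ 0
  have side : ∀ ε : ℝ, ε ≠ 0 → (∀ v ∈ vectorSpan ℝ s, ‖v‖ < r → 0 < ε * f v → v +ᵥ x ∈ s) ∨
      (∀ v ∈ vectorSpan ℝ s, ‖v‖ < r → 0 < ε * f v → v +ᵥ x ∉ s) := by
    intro ε hε
    by_contra! hcon
    obtain ⟨⟨v, hv, hvr, hvf, hvs⟩, w, hw, hwr, hwf, hws⟩ := hcon
    refine hvs (mem_of_isPreconnected hs (key ε) (fun u hu => hu.1.1) (fun u hu hu' => ?_)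
      (v := w) (w := v) ⟨⟨hw, by simpa using hwr⟩, hwf⟩ ⟨⟨hv, by simpa using hvr⟩, hvf⟩ hws)
    have h0 := (hf u hu.1.1 (by simpa using hu.1.2)).mp hu'
    have h1 : 0 < ε * f u := hu.2
    rw [h0, mul_zero] at h1
    exact lt_irrefl _ h1
  rcases side 1 one_ne_zero with hp | hp <;>
    rcases side (-1) (neg_ne_zero.mpr one_ne_zero) with hm | hm
  -- With both sides in `s`, the frontier point `x` would be interior.
  · refine absurd (mem_intrinsicInterior_iff.mpr ⟨hxs, r, hr, fun v hv hvr => ?_⟩) hxi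
    rcases lt_trichotomy (f v) 0 with h | h | h
    · exact hm v hv hvr (by linarith)
    · exact hz v hv hvr h
    · exact hp v hv hvr (by linarith)
  · right
    intro v hv hvr
    refine ⟨fun h => ?_, fun h => ?_⟩
    · by_contra! hlt
      exact hm v hv hvr (by linarith) h
    · rcases h.eq_or_lt with h | h
      · exact hz v hv hvr h.symm
      · exact hp v hv hvr (by linarith)
  · left
    intro v hv hvr
    refine ⟨fun h => ?_, fun h => ?_⟩
    · by_contra! hlt
      exact hp v hv hvr (by linarith) h
    · rcases h.eq_or_lt with h | h
      · exact hz v hv hvr h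
      · exact hm v hv hvr (by linarith)
  -- With both sides outside `s`, interior points close to `x` would have nowhere to lie.
  · exfalso
    obtain ⟨z, hzi, hzd⟩ := Metric.mem_closure_iff.mp (hds hxs) r hr
    have hv : z -ᵥ x ∈ vectorSpan ℝ s := vsub_mem_vectorSpan ℝ (intrinsicInterior_subset hzi) hxs
    have hvr : ‖z -ᵥ x‖ < r := by rwa [← dist_eq_norm_vsub, dist_comm]
    rcases lt_trichotomy (f (z -ᵥ x)) 0 with h | h | h
    · exact hm _ hv hvr (by linarith) (by simpa using intrinsicInterior_subset hzi)
    · have := (hf _ hv hvr).mpr h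
      rw [vsub_vadd] at this
      exact ((mem_intrinsicFrontier_iff hs).mp this).2 hzi
    · exact hp _ hv hvr (by linarith) (by simpa using intrinsicInterior_subset hzi)

/-! ### Topology of a single polytope -/

section Polytope

lemma IsPolytope.finrank_vectorSpan {p : ℕ} {X : Set A} (h : IsPolytope p X) :
    Module.finrank ℝ (vectorSpan ℝ X) = p := by
  cases p with
  | zero =>
    obtain ⟨a, rfl⟩ := h
    simp [vectorSpan_singleton]
  | succ p => exact h.1.1

lemma IsPolytope.dim_unique {p q : ℕ} {X : Set A} (h : IsPolytope p X) (h' : IsPolytope q X) :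
    p = q := by
  rw [← h.finrank_vectorSpan, h'.finrank_vectorSpan]

lemma IsFlatBall.isClosed {d : ℕ} {X : Set A} (h : IsFlatBall d X) : IsClosed X := by
  obtain ⟨-, e, -⟩ := h
  have : CompactSpace X := e.compactSpace
  exact (isCompact_iff_compactSpace.mpr this).isClosed

/-- The homeomorphism matches the sphere with the relative frontier, hence the open ball with the
relative interior. Connectedness and density of the interior are then inherited from the ball. -/
lemma IsFlatBall.exists_image_ball {d : ℕ} {X : Set A} (h : IsFlatBall d X) :
    ∃ φ : Metric.closedBall (0 : EuclideanSpace ℝ (Fin d)) 1 → A, Continuous φ ∧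
      Set.range φ = X ∧ φ '' (Subtype.val ⁻¹' Metric.ball 0 1) = intrinsicInterior ℝ X := by
  have hX := h.isClosed
  obtain ⟨-, e, he⟩ := h
  refine ⟨fun z => e z, continuous_subtype_val.comp e.continuous, ?_, ?_⟩
  · ext x
    exact ⟨by rintro ⟨z, rfl⟩; exact (e z).2, fun hx => ⟨e.symm ⟨x, hx⟩, by simp⟩⟩
  · have key : ∀ z, (e z : A) ∈ intrinsicInterior ℝ X ↔
        ‖(z : EuclideanSpace ℝ (Fin d))‖ < 1 := by
      intro z
      have h1 := he z
      rw [mem_intrinsicFrontier_iff hX, and_iff_right (e z).2] at h1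
      have h2 : ‖(z : EuclideanSpace ℝ (Fin d))‖ ≤ 1 := mem_closedBall_zero_iff.mp z.2
      rw [← not_iff_not, h1, not_lt]
      exact ⟨fun h => h.ge, fun h => le_antisymm h2 h⟩
    ext x
    constructor
    · rintro ⟨z, hz, rfl⟩
      exact (key z).mpr (by simpa using hz)
    · intro hx
      refine ⟨e.symm ⟨x, intrinsicInterior_subset hx⟩, ?_, by simp⟩
      have h1 := (key (e.symm ⟨x, intrinsicInterior_subset hx⟩)).mp (by simpa using hx)
      simpa using h1

lemma IsPolytope.isClosed {p : ℕ} {X : Set A} (h : IsPolytope p X) : IsClosed X := by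
  cases p with
  | zero =>
    obtain ⟨a, rfl⟩ := h
    exact isClosed_singleton
  | succ p => exact h.1.isClosed

lemma IsPolytope.nonempty_intrinsicInterior {p : ℕ} {X : Set A} (h : IsPolytope p X) :
    (intrinsicInterior ℝ X).Nonempty := by
  cases p with
  | zero =>
    obtain ⟨a, rfl⟩ := h
    simp
  | succ p =>
    obtain ⟨φ, -, -, h2⟩ := h.1.exists_image_ball
    rw [← h2]
    exact ⟨_, ⟨0, by simp⟩, by simp, rfl⟩

lemma IsPolytope.isPreconnected_intrinsicInterior {p : ℕ} {X : Set A} (h : IsPolytope p X) :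
    IsPreconnected (intrinsicInterior ℝ X) := by
  cases p with
  | zero =>
    obtain ⟨a, rfl⟩ := h
    simpa using isPreconnected_singleton
  | succ p =>
    obtain ⟨φ, hφ, -, h2⟩ := h.1.exists_image_ball
    rw [← h2]
    refine IsPreconnected.image ?_ _ hφ.continuousOn
    rw [← Topology.IsInducing.subtypeVal.isPreconnected_image, Subtype.image_preimage_coe,
      Set.inter_eq_right.mpr Metric.ball_subset_closedBall]
    exact (convex_ball _ _).isPreconnected

lemma IsPolytope.subset_closure_intrinsicInterior {p : ℕ} {X : Set A} (h : IsPolytope p X) :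
    X ⊆ closure (intrinsicInterior ℝ X) := by
  cases p with
  | zero =>
    obtain ⟨a, rfl⟩ := h
    simp
  | succ p =>
    obtain ⟨φ, hφ, h1, h2⟩ := h.1.exists_image_ball
    rw [← h2]
    nth_rw 1 [← h1]
    rintro _ ⟨z, rfl⟩
    refine image_closure_subset_closure_image hφ ⟨z, ?_, rfl⟩
    rw [closure_subtype, Subtype.image_preimage_coe,
      Set.inter_eq_right.mpr Metric.ball_subset_closedBall, closure_ball _ one_ne_zero]
    exact z.2

end Polytope

end

/-! ### Faces of a mesh and the local shape of a cell along a hyperface -/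

section

variable {V A : Type*} [NormedAddCommGroup V] [NormedSpace ℝ V] [MetricSpace A]
  [NormedAddTorsor V A]

namespace Mesh

variable {M : Mesh V A}

lemma IsHyperface.subset_intrinsicFrontier {b c : Set A} (h : M.IsHyperface b c) :
    b ⊆ intrinsicFrontier ℝ c := by
  obtain ⟨-, hc, p, -, hp⟩ := M.hyperface_mem b c h
  rw [M.boundary_eq p c hc hp]
  exact Set.subset_sUnion_of_mem h

lemma IsHyperface.subset {b c : Set A} (h : M.IsHyperface b c) : b ⊆ c := by
  obtain ⟨-, -, p, -, hp⟩ := M.hyperface_mem b c h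
  exact h.subset_intrinsicFrontier.trans (intrinsicFrontier_subset hp.isClosed)

lemma IsHyperface.isPolytope {b c : Set A} (h : M.IsHyperface b c) {p : ℕ}
    (hc : IsPolytope (p + 1) c) : IsPolytope p b := by
  obtain ⟨-, -, q, hq, hq'⟩ := M.hyperface_mem b c h
  obtain rfl := Nat.succ_injective (hc.dim_unique hq')
  exact hq

lemma subset_of_face {Z X : Set A} (h : Relation.ReflTransGen M.IsHyperface Z X) : Z ⊆ X := by
  induction h with
  | refl => exact subset_rfl
  | tail _ h ih => exact ih.trans (IsHyperface.subset h)

lemma dim_le_of_face {Z X : Set A} (h : Relation.ReflTransGen M.IsHyperface Z X) {q p : ℕ}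
    (hZ : IsPolytope q Z) (hX : IsPolytope p X) : q ≤ p := by
  induction h generalizing p with
  | refl => exact (hZ.dim_unique hX).le
  | tail _ h ih =>
    obtain ⟨-, -, k, hk, hk'⟩ := M.hyperface_mem _ _ h
    have := ih hk
    have := hX.dim_unique hk'
    omega

lemma face_eq_of_dim_eq {Z X : Set A} (h : Relation.ReflTransGen M.IsHyperface Z X) {p : ℕ}
    (hZ : IsPolytope p Z) (hX : IsPolytope p X) : Z = X := by
  rcases h.cases_tail with h | ⟨b, hb, h⟩
  · exact h.symm
  · obtain ⟨-, -, k, hk, hk'⟩ := M.hyperface_mem _ _ h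
    have := dim_le_of_face hb hZ hk
    have := hX.dim_unique hk'
    omega

lemma isHyperface_of_face {Z X : Set A} (h : Relation.ReflTransGen M.IsHyperface Z X) {p : ℕ}
    (hZ : IsPolytope p Z) (hX : IsPolytope (p + 1) X) : M.IsHyperface Z X := by
  rcases h.cases_tail with rfl | ⟨b, hb, h⟩
  · have := hZ.dim_unique hX
    omega
  · rwa [face_eq_of_dim_eq hb hZ (IsHyperface.isPolytope h hX)]

/-- A cell whose relative interior meets another cell is a face of it. -/
lemma face_of_mem_intrinsicInterior {X Y : Set A} (hX : X ∈ M.cells) (hY : Y ∈ M.cells) {y : A}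
    (hyX : y ∈ intrinsicInterior ℝ X) (hyY : y ∈ Y) :
    Relation.ReflTransGen M.IsHyperface X Y := by
  obtain ⟨S, hS, hXY⟩ := M.inter_eq X hX Y hY
  obtain ⟨Z, hZS, hyZ⟩ : y ∈ ⋃₀ S := hXY ▸ ⟨intrinsicInterior_subset hyX, hyY⟩
  obtain ⟨hZX, hZY⟩ := hS Z hZS
  -- A nontrivial chain from `Z` to `X` would put `y` in a hyperface of `X`, hence on its frontier.
  rcases hZX.cases_tail with rfl | ⟨b, hb, h⟩
  · exact hZY
  · obtain ⟨p, hp⟩ := M.isPolytope_cells X hX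
    have := IsHyperface.subset_intrinsicFrontier h (subset_of_face hb hyZ)
    exact absurd hyX ((mem_intrinsicFrontier_iff hp.isClosed).mp this).2

/-- The hyperfaces missing `x` are finitely many closed sets, so a small ball around `x` avoids them
all. -/
lemma exists_ball_mem_intrinsicFrontier_iff {p : ℕ} {c : Set A} (hc : c ∈ M.cells)
    (hp : IsPolytope (p + 1) c) (x : A) : ∃ r > 0, ∀ v : V, ‖v‖ < r →
      (v +ᵥ x ∈ intrinsicFrontier ℝ c ↔ ∃ b, M.IsHyperface b c ∧ x ∈ b ∧ v +ᵥ x ∈ b) := by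
  have hfin : {b | M.IsHyperface b c ∧ x ∉ b}.Finite :=
    M.finite_cells.subset fun b hb => (M.hyperface_mem b c hb.1).1
  have hcl : IsClosed (⋃ b ∈ {b | M.IsHyperface b c ∧ x ∉ b}, b) :=
    hfin.isClosed_biUnion fun b hb => (hb.1.isPolytope hp).isClosed
  obtain ⟨r, hr, h⟩ := exists_ball_disjoint (V := V) hcl (x := x) (by
    simp only [Set.mem_iUnion, not_exists]
    exact fun b hb hxb => hb.2 hxb)
  refine ⟨r, hr, fun v hv => ?_⟩
  rw [M.boundary_eq p c hc hp]
  constructor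
  · rintro ⟨b, hb, hvb⟩
    refine ⟨b, hb, ?_, hvb⟩
    by_contra hxb
    exact h v hv (Set.mem_biUnion (show b ∈ {b | M.IsHyperface b c ∧ x ∉ b} from ⟨hb, hxb⟩) hvb)
  · rintro ⟨b, hb, -, hvb⟩
    exact ⟨b, hb, hvb⟩

lemma IsHyperface.eq_of_mem_intrinsicInterior {b b' c c' : Set A} (hb : M.IsHyperface b c)
    (hb' : M.IsHyperface b' c') {p : ℕ} (hc : IsPolytope (p + 1) c) (hc' : IsPolytope (p + 1) c')
    {y : A} (hy : y ∈ intrinsicInterior ℝ b) (hy' : y ∈ b') : b = b' :=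
  face_eq_of_dim_eq (face_of_mem_intrinsicInterior (M.hyperface_mem _ _ hb).1
    (M.hyperface_mem _ _ hb').1 hy hy') (hb.isPolytope hc) (hb'.isPolytope hc')

/-- Near an interior point of a hyperface, the boundary of a cell is that hyperface. -/
lemma IsHyperface.exists_ball_mem_intrinsicFrontier_iff {b c : Set A} (h : M.IsHyperface b c)
    {y : A} (hy : y ∈ intrinsicInterior ℝ b) : ∃ r > 0, ∀ v : V, ‖v‖ < r →
      (v +ᵥ y ∈ intrinsicFrontier ℝ c ↔ v ∈ vectorSpan ℝ b) := by
  obtain ⟨-, hc, p, -, hp⟩ := M.hyperface_mem b c h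
  obtain ⟨r, hr, h1⟩ := Mesh.exists_ball_mem_intrinsicFrontier_iff hc hp y
  obtain ⟨hyb, r', hr', h2⟩ := mem_intrinsicInterior_iff.mp hy
  refine ⟨min r r', lt_min hr hr', fun v hv => ?_⟩
  rw [h1 v (hv.trans_le (min_le_left _ _))]
  constructor
  · rintro ⟨b', hb', hyb', hvb'⟩
    obtain rfl := h.eq_of_mem_intrinsicInterior hb' hp hp hy hyb'
    simpa using vsub_mem_vectorSpan ℝ hvb' hyb
  · exact fun hvb => ⟨b, h, hyb, h2 v hvb (hv.trans_le (min_le_right _ _))⟩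

end Mesh

/-- `f` cuts out the direction of `b` in that of `c`, and near every interior point of `b` the set
`c` is the half-space `f ≤ 0`. -/
structure IsSideFunctional (c b : Set A) (f : V →ₗ[ℝ] ℝ) : Prop where
  mem_iff : ∀ v ∈ vectorSpan ℝ c, v ∈ vectorSpan ℝ b ↔ f v = 0
  local_iff : ∀ y ∈ intrinsicInterior ℝ b, ∃ r > 0, ∀ v ∈ vectorSpan ℝ c, ‖v‖ < r →
    (v +ᵥ y ∈ c ↔ f v ≤ 0) ∧ (v +ᵥ y ∈ intrinsicInterior ℝ c ↔ f v < 0)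

lemma exists_linearMap_mem_iff {U W : Submodule ℝ V} [FiniteDimensional ℝ W] (hUW : U ≤ W)
    (h : Module.finrank ℝ W = Module.finrank ℝ U + 1) :
    ∃ (f : V →ₗ[ℝ] ℝ) (n : V), n ∈ W ∧ f n ≠ 0 ∧ ∀ v ∈ W, v ∈ U ↔ f v = 0 := by
  obtain ⟨n, hnW, hnU⟩ : ∃ n ∈ W, n ∉ U := by
    by_contra! hle
    rw [le_antisymm hUW hle] at h
    omega
  obtain ⟨f, hfn, hfU⟩ := Submodule.exists_le_ker_of_notMem hnU
  refine ⟨f, n, hnW, hfn, fun v hv => ⟨fun hvU => hfU hvU, fun hfv => ?_⟩⟩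
  have hle : U ≤ LinearMap.ker f ⊓ W := le_inf hfU hUW
  have hlt : LinearMap.ker f ⊓ W < W :=
    lt_of_le_of_ne inf_le_right fun he => hfn ((he.ge hnW).1)
  have h1 := Submodule.finrank_lt_finrank_of_lt hlt
  have : FiniteDimensional ℝ (LinearMap.ker f ⊓ W : Submodule ℝ V) :=
    Submodule.finiteDimensional_of_le inf_le_right
  have h2 := Submodule.eq_of_le_of_finrank_le hle (by omega)
  rw [h2]
  exact ⟨hfv, hv⟩

/-- At each interior point of `b` one of `f` and `-f` works, by `exists_halfSpace`. The choice is
locally constant because `f` vanishes along `b`, and the interior of `b` is connected, so one sign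
serves everywhere. -/
lemma Mesh.IsHyperface.exists_isSideFunctional [FiniteDimensional ℝ V] {M : Mesh V A}
    {b c : Set A} (h : M.IsHyperface b c) : ∃ f : V →ₗ[ℝ] ℝ, IsSideFunctional c b f := by
  obtain ⟨-, hc, p, hbp, hcp⟩ := M.hyperface_mem b c h
  have hVbc : vectorSpan ℝ b ≤ vectorSpan ℝ c := vectorSpan_mono ℝ h.subset
  obtain ⟨f, n, hn, hfn, hf⟩ := exists_linearMap_mem_iff hVbc
    (by rw [hbp.finrank_vectorSpan, hcp.finrank_vectorSpan])
  let Neg : (V →ₗ[ℝ] ℝ) → A → Prop := fun g y => ∃ r > 0, ∀ v ∈ vectorSpan ℝ c, ‖v‖ < r →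
    (v +ᵥ y ∈ c ↔ g v ≤ 0)
  have hor : ∀ y ∈ intrinsicInterior ℝ b, Neg f y ∨ Neg (-f) y := by
    intro y hy
    obtain ⟨r, hr, h1⟩ := h.exists_ball_mem_intrinsicFrontier_iff hy
    rcases exists_halfSpace hcp.isClosed hcp.subset_closure_intrinsicInterior f hr
      (fun v hv hvr => (h1 v hvr).trans (hf v hv)) with h2 | h2
    · exact Or.inl ⟨r, hr, h2⟩
    · exact Or.inr ⟨r, hr, fun v hv hvr => by simpa using h2 v hv hvr⟩
  have hnot : ∀ y, Neg f y → ¬ Neg (-f) y := by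
    rintro y ⟨r, hr, h1⟩ ⟨r', hr', h2⟩
    have h0 : Filter.Tendsto (fun t : ℝ => ‖t • n‖) (nhdsWithin 0 (Set.Ioi 0)) (nhds 0) := by
      have : Continuous fun t : ℝ => ‖t • n‖ := by fun_prop
      simpa using (this.tendsto 0).mono_left nhdsWithin_le_nhds
    obtain ⟨t, ⟨ht1, ht2⟩, ht0⟩ := ((h0.eventually_lt_const hr).and
      (h0.eventually_lt_const hr')|>.and self_mem_nhdsWithin).exists
    have h3 := h1 _ (Submodule.smul_mem _ t hn) ht1
    have h4 := h2 _ (Submodule.smul_mem _ t hn) ht2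
    rw [h3, LinearMap.neg_apply, map_smul, smul_eq_mul] at h4
    have h5 : t * f n ≠ 0 := mul_ne_zero (ne_of_gt ht0) hfn
    rcases h5.lt_or_gt with h5 | h5
    · linarith [h4.mp h5.le]
    · linarith [h4.mpr (by linarith)]
  have hloc : ∀ (g : V →ₗ[ℝ] ℝ), (∀ v ∈ vectorSpan ℝ b, g v = 0) →
      ∀ y ∈ intrinsicInterior ℝ b, Neg g y →
        ∀ᶠ z in nhdsWithin y (intrinsicInterior ℝ b), Neg g z := by
    rintro g hg y hy ⟨r, hr, h1⟩
    filter_upwards [self_mem_nhdsWithin, mem_nhdsWithin_of_mem_nhds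
      (Metric.ball_mem_nhds y (half_pos hr))] with z hz hzr
    have hw : z -ᵥ y ∈ vectorSpan ℝ b := vsub_mem_vectorSpan ℝ (intrinsicInterior_subset hz)
      (intrinsicInterior_subset hy)
    rw [Metric.mem_ball, dist_eq_norm_vsub V] at hzr
    -- Moving the base point along `b` does not change `g`; half the radius leaves room for the
    -- move.
    refine ⟨r / 2, half_pos hr, fun v hv hvr => ?_⟩
    have h2 := h1 (v + (z -ᵥ y)) (Submodule.add_mem _ hv (hVbc hw))
      (by linarith [norm_add_le v (z -ᵥ y)])
    rwa [add_vadd, vsub_vadd, map_add, hg _ hw, add_zero] at h2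
  have hfb : ∀ v ∈ vectorSpan ℝ b, f v = 0 := fun v hv => (hf v (hVbc hv)).mp hv
  have hconst : ∀ y ∈ intrinsicInterior ℝ b, ∀ z ∈ intrinsicInterior ℝ b, Neg f y → Neg f z := by
    intro y hy z hz
    refine hbp.isPreconnected_intrinsicInterior.induction₂' (fun y z => Neg f y → Neg f z)
      (fun u hu => ?_) (fun _ _ _ _ _ _ h1 h2 h3 => h2 (h1 h3)) hy hz
    rcases hor u hu with h1 | h1
    · filter_upwards [hloc f hfb u hu h1] with w hw
      exact ⟨fun _ => hw, fun _ => h1⟩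
    · filter_upwards [hloc (-f) (fun v hv => by simp [hfb v hv]) u hu h1] with w hw
      exact ⟨fun h2 => absurd h1 (hnot u h2), fun h2 => absurd hw (hnot w h2)⟩
  have finish : ∀ g : V →ₗ[ℝ] ℝ, (∀ v ∈ vectorSpan ℝ c, v ∈ vectorSpan ℝ b ↔ g v = 0) →
      (∀ y ∈ intrinsicInterior ℝ b, Neg g y) → IsSideFunctional c b g := by
    refine fun g hg hN => ⟨hg, fun y hy => ?_⟩
    obtain ⟨r, hr, h1⟩ := h.exists_ball_mem_intrinsicFrontier_iff hy
    obtain ⟨r', hr', h2⟩ := hN y hy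
    refine ⟨min r r', lt_min hr hr', fun v hv hvr => ?_⟩
    have h3 := h1 v (hvr.trans_le (min_le_left _ _))
    have h4 := h2 v hv (hvr.trans_le (min_le_right _ _))
    refine ⟨h4, ?_⟩
    rw [mem_intrinsicFrontier_iff hcp.isClosed, hg v hv, h4] at h3
    constructor
    · intro hi
      have h5 := h4.mp (intrinsicInterior_subset hi)
      exact lt_of_le_of_ne h5 fun h0 => (h3.mpr h0).2 hi
    · intro hlt
      by_contra hi
      exact hlt.ne (h3.mp ⟨hlt.le, hi⟩)
  obtain ⟨y, hy⟩ := hbp.nonempty_intrinsicInterior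
  rcases hor y hy with h1 | h1
  · exact ⟨f, finish f hf fun z hz => hconst y hy z hz h1⟩
  · refine ⟨-f, finish (-f) (fun v hv => by simpa using hf v hv) fun z hz => ?_⟩
    exact (hor z hz).resolve_left fun h2 => hnot y (hconst z hz y hy h2) h1

lemma IsSideFunctional.isOutward_iff {c b : Set A} {f : V →ₗ[ℝ] ℝ} (h : IsSideFunctional c b f)
    (hb : (intrinsicInterior ℝ b).Nonempty) (n : V) :
    IsOutward c b n ↔ n ∈ vectorSpan ℝ c ∧ 0 < f n := by
  have small : ∀ r > 0, ∃ δ > 0, ∀ t : ℝ, 0 < t → t < δ → ‖t • n‖ < r := by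
    intro r hr
    refine ⟨r / (‖n‖ + 1), by positivity, fun t ht0 ht => ?_⟩
    rw [lt_div_iff₀ (by positivity)] at ht
    rw [norm_smul, Real.norm_of_nonneg ht0.le]
    linarith
  constructor
  · rintro ⟨hn, hout⟩
    refine ⟨hn, ?_⟩
    obtain ⟨y, hy⟩ := hb
    obtain ⟨r, hr, h1⟩ := h.local_iff y hy
    obtain ⟨δ, hδ, h2⟩ := hout y hy
    obtain ⟨δ', hδ', h3⟩ := small r hr
    obtain ⟨t, ht0, ht⟩ := exists_between (lt_min hδ hδ')
    have h4 := (h2 t ht0 (ht.trans_le (min_le_left _ _))).1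
    rw [(h1 _ (Submodule.smul_mem _ t hn) (h3 t ht0 (ht.trans_le (min_le_right _ _)))).1,
      not_le, map_smul, smul_eq_mul] at h4
    exact pos_of_mul_pos_right h4 ht0.le
  · rintro ⟨hn, hfn⟩
    refine ⟨hn, fun y hy => ?_⟩
    obtain ⟨r, hr, h1⟩ := h.local_iff y hy
    obtain ⟨δ, hδ, h3⟩ := small r hr
    refine ⟨δ, hδ, fun t ht0 ht => ⟨?_, ?_⟩⟩
    · rw [(h1 _ (Submodule.smul_mem _ t hn) (h3 t ht0 ht)).1, not_le, map_smul, smul_eq_mul]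
      positivity
    · rw [(h1 _ (Submodule.neg_mem _ (Submodule.smul_mem _ t hn))
        (by rw [norm_neg]; exact h3 t ht0 ht)).2, map_neg, map_smul, smul_eq_mul, neg_lt_zero]
      positivity

end

/-! ### Counting the crossings of a loop around a codimension-two face -/

section

/-- A real function that is locally constant off finitely many points changes by the sum of its
jumps. -/
lemma sub_eq_sum_jumps {ι : Type*} [DecidableEq ι] (s : Finset ι) (t J : ι → ℝ) {lo hi : ℝ}
    (hlh : lo ≤ hi) (g : ℝ → ℝ) (hinj : Set.InjOn t s) (ht : ∀ i ∈ s, lo < t i ∧ t i < hi)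
    (hloc : ∀ x ∈ Set.Icc lo hi, (∀ i ∈ s, t i ≠ x) →
      ∀ᶠ y in nhdsWithin x (Set.Icc lo hi), g y = g x)
    (hjump : ∀ i ∈ s, ∃ L, (∀ᶠ y in nhdsWithin (t i) (Set.Iio (t i)), g y = L) ∧
      ∀ᶠ y in nhdsWithin (t i) (Set.Ioi (t i)), g y = L + J i) :
    g hi - g lo = ∑ i ∈ s, J i := by
  induction s using Finset.induction generalizing g with
  | empty =>
    rw [Finset.sum_empty, sub_eq_zero]
    refine isPreconnected_Icc.induction₂' (fun x y => g y = g x) (fun x hx => ?_)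
      (fun _ _ _ _ _ _ h1 h2 => h2.trans h1) (Set.left_mem_Icc.mpr hlh) (Set.right_mem_Icc.mpr hlh)
    filter_upwards [hloc x hx (by simp)] with y hy
    exact ⟨hy, hy.symm⟩
  | insert i s his ih =>
    obtain ⟨L, hL, hR⟩ := hjump i (Finset.mem_insert_self i s)
    rw [eventually_nhdsWithin_iff] at hL hR
    obtain ⟨hlo, hhi⟩ := ht i (Finset.mem_insert_self i s)
    -- Removing the jump at `t i` makes the function locally constant there and leaves the other
    -- jumps unchanged.
    let g' : ℝ → ℝ := fun y => if y < t i then g y else if y = t i then L else g y - J i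
    have hlt : ∀ y, y < t i → g' y = g y := fun y hy => if_pos hy
    have heq : g' (t i) = L := by simp [g']
    have hgt : ∀ y, t i < y → g' y = g y - J i := fun y hy => by
      simp only [g', if_neg hy.not_gt, if_neg hy.ne']
    have h := ih g' (hinj.mono (by simp)) (fun j hj => ht j (Finset.mem_insert_of_mem hj)) ?_ ?_
    · rw [hgt hi hhi, hlt lo hlo] at h
      rw [Finset.sum_insert his, ← h]
      ring
    · intro x hx hxs
      rcases lt_trichotomy x (t i) with hxi | rfl | hxi
      · filter_upwards [hloc x hx (by
          intro j hj
          rcases Finset.mem_insert.mp hj with rfl | hj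
          · exact hxi.ne'
          · exact hxs j hj), mem_nhdsWithin_of_mem_nhds (Iio_mem_nhds hxi)] with y hy hyi
        rw [hlt x hxi, hlt y hyi, hy]
      · filter_upwards [mem_nhdsWithin_of_mem_nhds hL, mem_nhdsWithin_of_mem_nhds hR] with y h1 h2
        rcases lt_trichotomy y (t i) with hy | rfl | hy
        · rw [hlt y hy, heq, h1 hy]
        · rfl
        · rw [hgt y hy, heq, h2 hy, add_sub_cancel_right]
      · filter_upwards [hloc x hx (by
          intro j hj
          rcases Finset.mem_insert.mp hj with rfl | hj
          · exact hxi.ne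
          · exact hxs j hj), mem_nhdsWithin_of_mem_nhds (Ioi_mem_nhds hxi)] with y hy hyi
        rw [hgt x hxi, hgt y hyi, hy]
    · intro j hj
      obtain ⟨L', h1, h2⟩ := hjump j (Finset.mem_insert_of_mem hj)
      have hne : t j ≠ t i := fun h => his
        (hinj (Finset.mem_insert_of_mem hj) (Finset.mem_insert_self i s) h ▸ hj)
      rcases hne.lt_or_gt with hji | hji
      · refine ⟨L', ?_, ?_⟩
        · filter_upwards [h1, mem_nhdsWithin_of_mem_nhds (Iio_mem_nhds hji)] with y hy hyi
          rw [hlt y hyi, hy]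
        · filter_upwards [h2, mem_nhdsWithin_of_mem_nhds (Iio_mem_nhds hji)] with y hy hyi
          rw [hlt y hyi, hy]
      · refine ⟨L' - J i, ?_, ?_⟩
        · filter_upwards [h1, mem_nhdsWithin_of_mem_nhds (Ioi_mem_nhds hji)] with y hy hyi
          rw [hgt y hyi, hy]
        · filter_upwards [h2, mem_nhdsWithin_of_mem_nhds (Ioi_mem_nhds hji)] with y hy hyi
          rw [hgt y hyi, hy]
          ring

lemma real_sign_mul (a b : ℝ) : Real.sign (a * b) = Real.sign a * Real.sign b := by
  rcases lt_trichotomy a 0 with ha | rfl | ha <;> rcases lt_trichotomy b 0 with hb | rfl | hb <;>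
    simp [Real.sign_of_neg, Real.sign_of_pos, mul_pos_of_neg_of_neg, mul_neg_of_neg_of_pos,
      mul_neg_of_pos_of_neg, *]

variable {V A : Type*} [NormedAddCommGroup V] [NormedSpace ℝ V] [MetricSpace A]
  [NormedAddTorsor V A]

/-- Two small vectors spanning a complement of `U` in `W`, the second in general position. -/
lemma exists_generic_pair {ι : Type*} [Fintype ι] {U W : Submodule ℝ V} [FiniteDimensional ℝ U]
    (h : Module.finrank ℝ W = Module.finrank ℝ U + 2) (F : ι → V →ₗ[ℝ] ℝ)
    (hF : ∀ i, ∃ v ∈ W, F i v ≠ 0) {r : ℝ} (hr : 0 < r) :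
    ∃ q ∈ W, ∃ w ∈ W, ‖q‖ + ‖w‖ < r ∧ (∀ i, |F i q| < |F i w|) ∧ ∀ t : ℝ, q + t • w ∉ U := by
  obtain ⟨w, hw, hFw⟩ := Module.Dual.exists_forall_mem_ne_zero_of_forall_exists W F hF
  -- Avoiding the span of `w` together with `U` keeps the whole line `q + t • w` off `U`.
  obtain ⟨q, hq, hqU⟩ : ∃ q ∈ W, q ∉ U ⊔ Submodule.span ℝ {w} := by
    by_contra! hle
    have h1 := Submodule.finrank_mono (R := ℝ) (s := W) (t := U ⊔ Submodule.span ℝ {w}) hle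
    have h2 := Submodule.finrank_add_le_finrank_add_finrank U (Submodule.span ℝ {w})
    have h3 := finrank_span_le_card (R := ℝ) ({w} : Set V)
    simp only [Set.toFinset_singleton, Finset.card_singleton] at h3
    omega
  have hqt : ∀ t : ℝ, q + t • w ∉ U := fun t ht => hqU <| by
    have h1 := Submodule.sub_mem _ (Submodule.mem_sup_left ht : q + t • w ∈
      U ⊔ Submodule.span ℝ {w}) (Submodule.mem_sup_right
        (Submodule.smul_mem _ t (Submodule.mem_span_singleton_self w)))
    rwa [add_sub_cancel_right] at h1
  -- Stretching `w` by `T` makes it dominate `q` under every `F i`; the common factor `η` below then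
  -- makes both vectors short.
  let T : ℝ := 1 + ∑ i, |F i q| / |F i w|
  have hT : 0 < T := by positivity
  have hTi : ∀ i, |F i q| < T * |F i w| := by
    intro i
    rw [← div_lt_iff₀ (abs_pos.mpr (hFw i))]
    have := Finset.single_le_sum (f := fun i => |F i q| / |F i w|)
      (fun i _ => by positivity) (Finset.mem_univ i)
    simp only [T]
    linarith
  let η : ℝ := r / (‖q‖ + ‖T • w‖ + 1)
  have hη : 0 < η := by positivity
  refine ⟨η • q, Submodule.smul_mem _ _ hq, η • T • w,
    Submodule.smul_mem _ _ (Submodule.smul_mem _ _ hw), ?_, fun i => ?_, fun t ht => ?_⟩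
  · rw [norm_smul, norm_smul η, ← mul_add, Real.norm_of_nonneg hη.le, div_mul_eq_mul_div,
      div_lt_iff₀ (by positivity)]
    nlinarith
  · rw [map_smul, map_smul, map_smul, smul_eq_mul, smul_eq_mul, smul_eq_mul, abs_mul, abs_mul,
      abs_mul, abs_of_pos hT]
    exact mul_lt_mul_of_pos_left (hTi i) (abs_pos.mpr hη.ne')
  · refine hqt (t * T) ?_
    have h1 := Submodule.smul_mem _ η⁻¹ ht
    rwa [smul_add, smul_smul, inv_mul_cancel₀ hη.ne', one_smul, smul_comm t η, smul_smul η⁻¹,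
      inv_mul_cancel₀ hη.ne', one_smul, smul_smul] at h1

open Classical in
/-- If the relative boundary of `c` is near `x` a fan of half-hyperplanes `G i ≤ 0` in `b i`, then
`c` lies alternately on either side of them as one turns around `x`. -/
lemma exists_alternating {ι : Type*} [Fintype ι] {c : Set A} (hc : IsClosed c)
    {U : Submodule ℝ V} [FiniteDimensional ℝ U] {x : A} {b : ι → Set A}
    (hU : Module.finrank ℝ (vectorSpan ℝ c) = Module.finrank ℝ U + 2)
    {F G : ι → V →ₗ[ℝ] ℝ} (hF : ∀ i, IsSideFunctional c (b i) (F i))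
    (hF0 : ∀ i, ∃ v ∈ vectorSpan ℝ c, F i v ≠ 0)
    (hG : ∀ i, ∀ v ∈ vectorSpan ℝ (b i), G i v = 0 → v ∈ U)
    {r : ℝ} (hr : 0 < r)
    (hfr : ∀ v ∈ vectorSpan ℝ c, ‖v‖ < r → v +ᵥ x ∈ intrinsicFrontier ℝ c →
      ∃ i, v ∈ vectorSpan ℝ (b i) ∧ G i v ≤ 0)
    (hint : ∀ i, ∀ v ∈ vectorSpan ℝ (b i), ‖v‖ < r → G i v < 0 →
      v +ᵥ x ∈ intrinsicInterior ℝ (b i))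
    (hinj : ∀ i j, ∀ v : V, v +ᵥ x ∈ intrinsicInterior ℝ (b i) → v +ᵥ x ∈ intrinsicInterior ℝ (b j) →
      i = j) :
    ∃ q ∈ vectorSpan ℝ c, ∃ w ∈ vectorSpan ℝ c, ∃ t τ : ι → ℝ,
      (∀ i, (τ i = 1 ∨ τ i = -1) ∧ q + t i • w ∈ vectorSpan ℝ (b i) ∧
        G i (τ i • (q + t i • w)) < 0 ∧ F i w ≠ 0) ∧
      ∑ i, τ i * Real.sign (F i w) = 0 := by
  obtain ⟨q, hq, w, hw, hqw, hFqw, hqU⟩ := exists_generic_pair hU F hF0 hr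
  have hFw : ∀ i, F i w ≠ 0 := fun i h => by
    have := hFqw i
    rw [h, abs_zero] at this
    exact absurd (abs_nonneg _) this.not_ge
  -- The parameter at which the line `q + y • w` crosses the hyperplane of `b i`.
  let t : ι → ℝ := fun i => -F i q / F i w
  have ht : ∀ i y, F i (q + y • w) = (y - t i) * F i w := fun i y => by
    simp only [t, map_add, map_smul, smul_eq_mul]
    field_simp [hFw i]
    ring
  have ht1 : ∀ i, |t i| < 1 := fun i => by
    rw [abs_div, abs_neg, div_lt_one (abs_pos.mpr (hFw i))]
    exact hFqw i
  have hmem : ∀ y : ℝ, q + y • w ∈ vectorSpan ℝ c := fun y =>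
    Submodule.add_mem _ hq (Submodule.smul_mem _ _ hw)
  have hub : ∀ i, q + t i • w ∈ vectorSpan ℝ (b i) := fun i =>
    ((hF i).mem_iff _ (hmem _)).mpr (by rw [ht, sub_self, zero_mul])
  have hGu : ∀ i, G i (q + t i • w) ≠ 0 := fun i h => hqU (t i) (hG i _ (hub i) h)
  -- The choice between the two opposite crossing points: `τ i` selects the one inside the
  -- half-hyperplane.
  let τ : ι → ℝ := fun i => if G i (q + t i • w) < 0 then 1 else -1
  have hτ : ∀ i, τ i = 1 ∨ τ i = -1 := fun i => by
    by_cases h : G i (q + t i • w) < 0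
    · exact Or.inl (if_pos h)
    · exact Or.inr (if_neg h)
  have hGτ : ∀ i, G i (τ i • (q + t i • w)) < 0 := fun i => by
    rw [map_smul, smul_eq_mul]
    by_cases h : G i (q + t i • w) < 0
    · rwa [show τ i = 1 from if_pos h, one_mul]
    · have : 0 < G i (q + t i • w) := lt_of_le_of_ne (not_lt.mp h) (hGu i).symm
      simp only [τ, if_neg h]
      linarith
  have hnorm : ∀ α β : ℝ, |α| ≤ 1 → |β| ≤ 1 → ‖α • q + β • w‖ < r := fun α β hα hβ => by
    refine lt_of_le_of_lt ((norm_add_le _ _).trans ?_) hqw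
    rw [norm_smul, norm_smul]
    exact add_le_add (mul_le_of_le_one_left (norm_nonneg _) hα)
      (mul_le_of_le_one_left (norm_nonneg _) hβ)
  refine ⟨q, hq, w, hw, t, τ, fun i => ⟨hτ i, hub i, hGτ i, hFw i⟩, ?_⟩
  let χ : V → ℝ := fun v => if v +ᵥ x ∈ c then 1 else 0
  -- The two sides of the parallelogram parallel to `w`: the side with sign `ε` meets exactly the `b
  -- i` with `τ i = ε`.
  have side : ∀ ε : ℝ, (ε = 1 ∨ ε = -1) →
      χ (ε • (q + (1 : ℝ) • w)) - χ (ε • (q + (-1 : ℝ) • w)) =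
        ∑ i with τ i = ε, -(τ i * Real.sign (F i w)) := by
    intro ε hε
    have hε0 : ε ≠ 0 := by rcases hε with rfl | rfl <;> norm_num
    have hε1 : |ε| ≤ 1 := by rcases hε with rfl | rfl <;> norm_num
    have hr' : ∀ y : ℝ, |y| ≤ 1 → ‖ε • (q + y • w)‖ < r := fun y hy => by
      rw [norm_smul, Real.norm_eq_abs]
      refine lt_of_le_of_lt (mul_le_of_le_one_left (norm_nonneg _) hε1) ?_
      simpa using hnorm 1 y (by simp) hy
    have hci : ∀ i, τ i = ε → ε • (q + t i • w) +ᵥ x ∈ intrinsicInterior ℝ (b i) := by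
      rintro i rfl
      exact hint i _ (Submodule.smul_mem _ _ (hub i)) (hr' _ (ht1 i).le) (hGτ i)
    refine sub_eq_sum_jumps _ t _ (by norm_num) (fun y => χ (ε • (q + y • w))) ?_ ?_ ?_ ?_
    · intro i hi j hj hij
      have hi' := hci i (by simpa using hi)
      rw [hij] at hi'
      exact hinj i j _ hi' (hci j (by simpa using hj))
    · exact fun i _ => abs_lt.mp (ht1 i)
    · intro y hy hyt
      have hcont : Continuous fun y : ℝ => ε • (q + y • w) := by fun_prop
      have hmem' : ∀ y : ℝ, ε • (q + y • w) ∈ vectorSpan ℝ c := fun y =>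
        Submodule.smul_mem _ _ (hmem y)
      have htend : Filter.Tendsto (fun y : ℝ => ε • (q + y • w)) (nhds y)
          (nhdsWithin (ε • (q + y • w)) (vectorSpan ℝ c)) :=
        tendsto_nhdsWithin_iff.mpr ⟨hcont.tendsto y, Filter.Eventually.of_forall hmem'⟩
      refine nhdsWithin_le_nhds (htend.eventually (eventually_mem_iff hc (x := x) (hmem' y) ?_) |>.mono
        fun z hz => by simp only [χ, hz])
      intro hfrt
      obtain ⟨i, hi, hGi⟩ := hfr _ (hmem' y) (hr' y (abs_le.mpr hy)) hfrt
      have h0 := ((hF i).mem_iff _ (hmem' y)).mp hi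
      rw [map_smul, ht, smul_eq_mul] at h0
      have hyi : t i = y := by
        rcases mul_eq_zero.mp h0 with h | h
        · exact absurd h hε0
        · linarith [(mul_eq_zero.mp h).resolve_right (hFw i)]
      refine hyt i (Finset.mem_filter.mpr ⟨Finset.mem_univ i, ?_⟩) hyi
      have h1 := hGτ i
      rw [map_smul, smul_eq_mul] at h1 hGi
      rw [← hyi] at hGi
      rcases hτ i with h | h <;> rcases hε with h' | h' <;> rw [h] at h1 ⊢ <;> rw [h'] at hGi ⊢ <;>
        linarith
    · intro i hi
      have hτi : τ i = ε := by simpa using hi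
      obtain ⟨δ, hδ, hloc⟩ := (hF i).local_iff _ (hci i hτi)
      have hev : ∀ᶠ y in nhds (t i), (ε • (q + y • w) +ᵥ x ∈ c ↔ ε * (y - t i) * F i w ≤ 0) := by
        have hcont : Continuous fun y : ℝ => ‖(ε * (y - t i)) • w‖ := by fun_prop
        have h0 : Filter.Tendsto (fun y : ℝ => ‖(ε * (y - t i)) • w‖) (nhds (t i)) (nhds 0) := by
          simpa using hcont.tendsto (t i)
        filter_upwards [h0.eventually_lt_const hδ] with y hy
        have h1 := (hloc _ (Submodule.smul_mem _ _ hw) hy).1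
        rw [vadd_vadd, map_smul, smul_eq_mul] at h1
        rw [← h1]
        have : (ε * (y - t i)) • w + ε • (q + t i • w) = ε • (q + y • w) := by module
        rw [this]
      rw [hτi]
      have hne : ε * F i w ≠ 0 := mul_ne_zero hε0 (hFw i)
      have hsgn : ε * Real.sign (F i w) = Real.sign (ε * F i w) := by
        rw [real_sign_mul]
        rcases hε with rfl | rfl <;> simp [Real.sign_neg, Real.sign_one]
      rw [hsgn]
      rcases hne.lt_or_gt with hneg | hpos
      · refine ⟨0, ?_, ?_⟩
        · filter_upwards [nhdsWithin_le_nhds hev, self_mem_nhdsWithin] with y hy hyt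
          refine if_neg (hy.not.mpr (not_le.mpr ?_))
          have : y - t i < 0 := sub_neg.mpr hyt
          nlinarith [mul_pos_of_neg_of_neg this hneg]
        · filter_upwards [nhdsWithin_le_nhds hev, self_mem_nhdsWithin] with y hy hyt
          rw [Real.sign_of_neg hneg, neg_neg, zero_add]
          refine if_pos (hy.mpr ?_)
          have : 0 < y - t i := sub_pos.mpr hyt
          nlinarith [mul_neg_of_pos_of_neg this hneg]
      · refine ⟨1, ?_, ?_⟩
        · filter_upwards [nhdsWithin_le_nhds hev, self_mem_nhdsWithin] with y hy hyt
          refine if_pos (hy.mpr ?_)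
          have : y - t i < 0 := sub_neg.mpr hyt
          nlinarith [mul_neg_of_neg_of_pos this hpos]
        · filter_upwards [nhdsWithin_le_nhds hev, self_mem_nhdsWithin] with y hy hyt
          rw [Real.sign_of_pos hpos, add_neg_cancel]
          refine if_neg (hy.not.mpr (not_le.mpr ?_))
          have : 0 < y - t i := sub_pos.mpr hyt
          nlinarith [mul_pos this hpos]
  -- The sides parallel to `q` miss the frontier, since `|F i q| < |F i w|` keeps them off every
  -- hyperplane.
  have ends : ∀ δ : ℝ, (δ = 1 ∨ δ = -1) → χ (δ • w + (1 : ℝ) • q) = χ (δ • w + (-1 : ℝ) • q) := by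
    intro δ hδ
    have hδ1 : |δ| = 1 := by rcases hδ with rfl | rfl <;> norm_num
    have hcont : Continuous fun s : ℝ => δ • w + s • q := by fun_prop
    have hpre : IsPreconnected ((fun s : ℝ => δ • w + s • q) '' Set.Icc (-1) 1) :=
      isPreconnected_Icc.image _ hcont.continuousOn
    have hsub : (fun s : ℝ => δ • w + s • q) '' Set.Icc (-1) 1 ⊆ vectorSpan ℝ c := by
      rintro _ ⟨s, -, rfl⟩
      exact Submodule.add_mem _ (Submodule.smul_mem _ _ hw) (Submodule.smul_mem _ _ hq)
    have hd : ∀ v ∈ (fun s : ℝ => δ • w + s • q) '' Set.Icc (-1) 1,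
        v +ᵥ x ∉ intrinsicFrontier ℝ c := by
      rintro v hv hvf
      have hvc := hsub hv
      obtain ⟨s, hs, rfl⟩ := hv
      have hs1 : |s| ≤ 1 := abs_le.mpr hs
      obtain ⟨i, hi, -⟩ := hfr _ hvc (by
        dsimp only
        rw [add_comm]
        exact hnorm s δ hs1 hδ1.le) hvf
      have h0 := ((hF i).mem_iff _ hvc).mp hi
      simp only [map_add, map_smul, smul_eq_mul] at h0
      have h1 : |δ * F i w| = |s * F i q| := by
        rw [eq_neg_of_add_eq_zero_left h0, abs_neg]
      rw [abs_mul, abs_mul, hδ1, one_mul] at h1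
      have h2 := mul_le_of_le_one_left (abs_nonneg (F i q)) hs1
      linarith [hFqw i]
    have hp : δ • w + (1 : ℝ) • q ∈ (fun s : ℝ => δ • w + s • q) '' Set.Icc (-1) 1 :=
      ⟨1, by simp, rfl⟩
    have hm : δ • w + (-1 : ℝ) • q ∈ (fun s : ℝ => δ • w + s • q) '' Set.Icc (-1) 1 :=
      ⟨-1, by simp, rfl⟩
    have hiff : ((δ • w + (1 : ℝ) • q) +ᵥ x ∈ c) ↔ ((δ • w + (-1 : ℝ) • q) +ᵥ x ∈ c) :=
      ⟨mem_of_isPreconnected hc hpre hsub hd hp hm, mem_of_isPreconnected hc hpre hsub hd hm hp⟩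
    simp only [χ, hiff]
  have h1 := side 1 (Or.inl rfl)
  have h2 := side (-1) (Or.inr rfl)
  have h3 := ends 1 (Or.inl rfl)
  have h4 := ends (-1) (Or.inr rfl)
  have e1 : (1 : ℝ) • (q + (1 : ℝ) • w) = (1 : ℝ) • w + (1 : ℝ) • q := by module
  have e2 : (1 : ℝ) • (q + (-1 : ℝ) • w) = (-1 : ℝ) • w + (1 : ℝ) • q := by module
  have e3 : (-1 : ℝ) • (q + (1 : ℝ) • w) = (-1 : ℝ) • w + (-1 : ℝ) • q := by module
  have e4 : (-1 : ℝ) • (q + (-1 : ℝ) • w) = (1 : ℝ) • w + (-1 : ℝ) • q := by module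
  rw [e1, e2] at h1
  rw [e3, e4] at h2
  have hfil : (Finset.univ.filter fun i => τ i = -1) = Finset.univ.filter fun i => ¬ τ i = 1 := by
    refine Finset.filter_congr fun i _ => ?_
    rcases hτ i with h | h <;> rw [h] <;> norm_num
  rw [hfil] at h2
  have h5 := Finset.sum_filter_add_sum_filter_not Finset.univ (fun i => τ i = 1)
    (fun i => -(τ i * Real.sign (F i w)))
  rw [← h1, ← h2, h3, h4, Finset.sum_neg_distrib] at h5
  linarith

end

/-! ### Cancellation in the double boundary -/

namespace Mesh

open Classical in
lemma boundary_single_apply {V A : Type*} [NormedAddCommGroup V] [NormedSpace ℝ V]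
    [MetricSpace A] [NormedAddTorsor V A] {M : Mesh V A} (o : M.Orientation) {p : ℕ} (b : M.Cell (p + 1)) (r : ℝ)
    (a : M.Cell p) : boundary o p (Finsupp.single b r) a =
      if M.IsHyperface a.1 b.1 then r * relOrientation o b a else 0 := by
  rw [boundary, Finsupp.linearCombination_single, Finsupp.smul_apply, Finsupp.finsetSum_apply,
    smul_eq_mul]
  simp only [Finsupp.single_apply]
  rw [Finset.sum_ite_eq']
  simp

variable {V A : Type*} [NormedAddCommGroup V] [NormedSpace ℝ V] [FiniteDimensional ℝ V]
  [MetricSpace A] [NormedAddTorsor V A] {M : Mesh V A}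

/-- The top exterior power of the direction of `c` is a line, so `n ∧ ω` is a multiple of `η`, and a
nonzero one because `n` is not along `b`. -/
lemma IsHyperface.exists_relOrientation_eq (o : M.Orientation) {p : ℕ} {c : M.Cell (p + 1)}
    {b : M.Cell p} (h : M.IsHyperface b.1 c.1) {f : V →ₗ[ℝ] ℝ} (hf : IsSideFunctional c.1 b.1 f)
    {n : V} (hn : n ∈ vectorSpan ℝ c.1) (hfn : 0 < f n) {ω η} (hω : Represents ω (o p b))
    (hη : Represents η (o (p + 1) c)) :
    ∃ s : ℝ, ExteriorAlgebra.ι ℝ n * toAmbient _ ω = s • toAmbient _ η ∧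
      relOrientation o c b = Real.sign s := by
  obtain ⟨ω', hω'⟩ := exists_toAmbient_eq_of_le (vectorSpan_mono ℝ h.subset) ω
  obtain ⟨ζ, hζ⟩ := exists_toAmbient_eq_ι_mul hn ω'
  obtain ⟨s, rfl⟩ := exists_smul_of_finrank_eq c.2.2.finrank_vectorSpan hη.choose ζ
  rw [hω', toAmbient_smul] at hζ
  refine ⟨s, hζ.symm, ?_⟩
  have hout := hf.isOutward_iff b.2.2.nonempty_intrinsicInterior
  refine relOrientation_eq_sign o f b.2.2.finrank_vectorSpan
    (fun v hv hv0 => (hf.mem_iff v hv).mpr hv0) hout ((hout n).mpr ⟨hn, hfn⟩) hω hη ?_ hζ.symm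
  rintro rfl
  rw [zero_smul] at hζ
  exact ι_mul_toAmbient_ne_zero (fun hnb => hfn.ne' ((hf.mem_iff n hn).mp hnb)) hω.choose hζ.symm

open Classical in
/-- The contributions to `∂ ∂ c` at a fixed cell `a` cancel. -/
lemma sum_relOrientation_mul_eq_zero (o : M.Orientation) {p : ℕ} (c : M.Cell (p + 2))
    (a : M.Cell p) :
    ∑ b : M.Cell (p + 1) with M.IsHyperface b.1 c.1 ∧ M.IsHyperface a.1 b.1,
      relOrientation o c b * relOrientation o b a = 0 := by
  let ι := {b : M.Cell (p + 1) // M.IsHyperface b.1 c.1 ∧ M.IsHyperface a.1 b.1}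
  rw [Finset.sum_subtype (p := fun b : M.Cell (p + 1) =>
    M.IsHyperface b.1 c.1 ∧ M.IsHyperface a.1 b.1) _ (by simp)]
  change ∑ i : ι, relOrientation o c i.1 * relOrientation o i.1 a = 0
  choose F hF using fun i : ι => i.2.1.exists_isSideFunctional
  choose G hG using fun i : ι => i.2.2.exists_isSideFunctional
  obtain ⟨x, hx⟩ := a.2.2.nonempty_intrinsicInterior
  have hxa : x ∈ a.1 := intrinsicInterior_subset hx
  choose ρ hρ0 hρ using fun i : ι => (hG i).local_iff x hx
  obtain ⟨ρ', hρ'0, hρ'⟩ := exists_ball_mem_intrinsicFrontier_iff (V := V) c.2.1 c.2.2 x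
  obtain ⟨r, ⟨hrρ, hrρ'⟩, hr⟩ : ∃ r : ℝ, ((∀ i, r < ρ i) ∧ r < ρ') ∧ 0 < r := by
    have h1 : ∀ᶠ r : ℝ in nhdsWithin 0 (Set.Ioi 0), ∀ i, r < ρ i :=
      Filter.eventually_all.mpr fun i => nhdsWithin_le_nhds (Iio_mem_nhds (hρ0 i))
    have h2 : ∀ᶠ r : ℝ in nhdsWithin 0 (Set.Ioi 0), r < ρ' :=
      nhdsWithin_le_nhds (Iio_mem_nhds hρ'0)
    exact ((h1.and h2).and self_mem_nhdsWithin).exists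
  obtain ⟨q, hq, w, hw, t, τ, hτ, hsum⟩ := exists_alternating (x := x) (r := r)
    (U := vectorSpan ℝ a.1) (b := fun i : ι => i.1.1) c.2.2.isClosed
    (by rw [c.2.2.finrank_vectorSpan, a.2.2.finrank_vectorSpan]) hF
    (fun i => by
      by_contra! hcon
      have h1 := Submodule.finrank_mono (R := ℝ) (s := vectorSpan ℝ c.1)
        (t := vectorSpan ℝ i.1.1) fun v hv => ((hF i).mem_iff v hv).mpr (hcon v hv)
      rw [c.2.2.finrank_vectorSpan, i.1.2.2.finrank_vectorSpan] at h1
      omega)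
    (fun i v hv hv0 => ((hG i).mem_iff v hv).mpr hv0) hr
    (fun v hv hvr hvf => by
      obtain ⟨b, hb, hxb, hvb⟩ := (hρ' v (hvr.trans hrρ')).mp hvf
      have hbp := hb.isPolytope c.2.2
      have hbM := (M.hyperface_mem _ _ hb).1
      -- A hyperface of `c` through the interior point `x` of `a` has `a` as a face, and the
      -- dimensions make it a hyperface.
      let i : ι := ⟨⟨b, hbM, hbp⟩, hb, isHyperface_of_face
        (face_of_mem_intrinsicInterior a.2.1 hbM hx hxb) a.2.2 hbp⟩
      have hvi : v ∈ vectorSpan ℝ b := by simpa using vsub_mem_vectorSpan ℝ hvb hxb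
      exact ⟨i, hvi, ((hρ i v hvi (hvr.trans (hrρ i))).1).mp hvb⟩)
    (fun i v hv hvr hGv => ((hρ i v hv (hvr.trans (hrρ i))).2).mpr hGv)
    (fun i j v hi hj => Subtype.ext (Subtype.ext (i.2.1.eq_of_mem_intrinsicInterior j.2.1 c.2.2
      c.2.2 hi (intrinsicInterior_subset hj))))
  obtain ⟨ωa, hωa⟩ := exists_represents (o p a)
  obtain ⟨ωc, hωc⟩ := exists_represents (o (p + 2) c)
  -- Comparing with `ωc` needs `a ⊆ c`, which is obtained from an intermediate cell; without one the
  -- sum is empty.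
  have hs : ∃ s : ℝ, ExteriorAlgebra.ι ℝ w * (ExteriorAlgebra.ι ℝ q * toAmbient _ ωa) =
      s • toAmbient _ ωc ∨ IsEmpty ι := by
    by_cases hι : IsEmpty ι
    · exact ⟨0, Or.inr hι⟩
    · obtain ⟨i⟩ := not_isEmpty_iff.mp hι
      obtain ⟨ω', hω'⟩ := exists_toAmbient_eq_of_le
        (vectorSpan_mono ℝ (i.2.2.subset.trans i.2.1.subset)) ωa
      obtain ⟨ζ, hζ⟩ := exists_toAmbient_eq_ι_mul hq ω'
      obtain ⟨ξ, hξ⟩ := exists_toAmbient_eq_ι_mul hw ζ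
      obtain ⟨s, rfl⟩ := exists_smul_of_finrank_eq c.2.2.finrank_vectorSpan hωc.choose ξ
      exact ⟨s, Or.inl (by rw [← hω', ← hζ, ← hξ, toAmbient_smul])⟩
  obtain ⟨s, hs | hι⟩ := hs
  swap
  · simp
  have key : ∀ i : ι, relOrientation o c i.1 * relOrientation o i.1 a =
      -Real.sign s * (τ i * Real.sign (F i w)) := by
    intro i
    obtain ⟨hτi, hub, hGu, hFw⟩ := hτ i
    obtain ⟨ωb, hωb⟩ := exists_represents (o (p + 1) i.1)
    have hσ : 0 < F i (Real.sign (F i w) • w) := by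
      rw [map_smul, smul_eq_mul]
      exact Real.sign_mul_pos_of_ne_zero _ hFw
    obtain ⟨s₁, h1, h1'⟩ := i.2.1.exists_relOrientation_eq o (hF i)
      (Submodule.smul_mem _ (Real.sign (F i w)) hw) hσ hωb hωc
    obtain ⟨s₂, h2, h2'⟩ := i.2.2.exists_relOrientation_eq o (hG i)
      (n := -(τ i • (q + t i • w))) (Submodule.neg_mem _ (Submodule.smul_mem _ _ hub))
      (by rw [map_neg]; linarith) hωa hωb
    have h3 : (s₂ * s₁) • toAmbient _ ωc =
        (-s * (τ i * Real.sign (F i w))) • toAmbient _ ωc := by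
      -- This removes the `t i • w` part of the second outward vector, leaving only signs that
      -- depend on `i`.
      have hww : ExteriorAlgebra.ι ℝ w * (ExteriorAlgebra.ι ℝ w * toAmbient _ ωa) = 0 := by
        rw [← mul_assoc, ExteriorAlgebra.ι_sq_zero, zero_mul]
      have h4 : (s₂ * s₁) • toAmbient _ ωc = ExteriorAlgebra.ι ℝ (Real.sign (F i w) • w) *
          (ExteriorAlgebra.ι ℝ (-(τ i • (q + t i • w))) * toAmbient _ ωa) := by
        rw [h2, mul_smul_comm, h1, smul_smul]
      rw [h4]
      simp only [map_neg, map_smul, map_add, smul_add, neg_mul, add_mul, smul_mul_assoc, mul_neg,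
        mul_add, mul_smul_comm, hww, hs, smul_zero, add_zero, smul_smul, neg_smul]
      congr 2
      ring
    rw [← toAmbient_smul, ← toAmbient_smul] at h3
    have h5 : s₂ * s₁ = -s * (τ i * Real.sign (F i w)) :=
      smul_left_injective ℝ hωc.choose (toAmbient_injective _ h3)
    rw [h1', h2', ← real_sign_mul, mul_comm s₁, h5, real_sign_mul, Real.sign_neg, real_sign_mul]
    congr 2
    · rcases hτi with h | h <;> rw [h] <;> simp [Real.sign_neg, Real.sign_one]
    · rcases hFw.lt_or_gt with h | h
      · simp [Real.sign_of_neg h, Real.sign_neg, Real.sign_one]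
      · simp [Real.sign_of_pos h, Real.sign_one]
  rw [Finset.sum_congr rfl fun i _ => key i, ← Finset.mul_sum, hsum, mul_zero]

theorem boundary_comp_boundary (o : M.Orientation) (p : ℕ) :
    boundary o p ∘ₗ boundary o (p + 1) = 0 := by
  classical
  refine Finsupp.lhom_ext' fun c => LinearMap.ext_ring (Finsupp.ext fun a => ?_)
  have h := sum_relOrientation_mul_eq_zero o c a
  rw [Finset.sum_filter] at h
  simp only [LinearMap.comp_apply, Finsupp.lsingle_apply, LinearMap.zero_apply,
    Finsupp.zero_apply]
  rw [show boundary o (p + 1) (Finsupp.single c 1) = _ from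
    Finsupp.linearCombination_single _ _ _, one_smul, map_sum, Finsupp.finsetSum_apply,
    Finset.sum_filter]
  refine (Finset.sum_congr rfl fun b _ => ?_).trans h
  rw [boundary_single_apply]
  by_cases h1 : M.IsHyperface b.1 c.1 <;> by_cases h2 : M.IsHyperface a.1 b.1 <;> simp [h1, h2]

end Mesh

end PolyMesh

end

/-- For every oriented polytopal mesh, `∂ ∘ ∂ = 0`; hence the chain spaces and the boundary operators
form a chain complex, which vanishes above the dimension of the mesh. -/
theorem mainTheorem7 {V A : Type*} [NormedAddCommGroup V] [NormedSpace ℝ V] [FiniteDimensional ℝ V]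
    [MetricSpace A] [NormedAddTorsor V A] (M : PolyMesh.Mesh V A) (o : M.Orientation) :
    (∀ p : ℕ, PolyMesh.Mesh.boundary o p ∘ₗ PolyMesh.Mesh.boundary o (p + 1) = 0) ∧
    ∃ (K : ChainComplex (ModuleCat ℝ) ℕ) (e : ∀ p, K.X p ≅ ModuleCat.of ℝ (M.Chain p)),
      (∀ p, K.d (p + 1) p =
        (e (p + 1)).hom ≫ ModuleCat.ofHom (PolyMesh.Mesh.boundary o p) ≫ (e p).inv) ∧
      ∀ d, M.HasDim d → ∀ p, d < p → Limits.IsZero (K.X p) := by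
  have h := PolyMesh.Mesh.boundary_comp_boundary o
  refine ⟨h, ChainComplex.of (fun p => ModuleCat.of ℝ (M.Chain p))
    (fun p => ModuleCat.ofHom (PolyMesh.Mesh.boundary o p)) (fun p => ?_),
    fun p => Iso.refl _, fun p => ?_, fun d hd p hp => ?_⟩
  · rw [← ModuleCat.ofHom_comp, h]
    rfl
  · refine (ChainComplex.of_d (fun p => ModuleCat.of ℝ (M.Chain p))
      (fun p => ModuleCat.ofHom (PolyMesh.Mesh.boundary o p)) p).trans ?_
    simp
  · have : IsEmpty (M.Cell p) := not_nonempty_iff.mp fun hne => absurd (hd.2 hne) hp.not_ge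
    change Limits.IsZero (ModuleCat.of ℝ (M.Chain p))
    exact ModuleCat.isZero_of_subsingleton _
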